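/- Let $H$ be a complex Hilbert space and let $B_s(H)$ be the set of all bounded self-adjoint linear operators on $H$, with the metric \[ d_m(A,B)=\sup_{x\in H,\ \|x\|=1}|\langle (A-B)x,x\rangle|=\|A-B\| . \] Let $\phi:B_s(H)\to B_s(H)$ be a bijective transformation (linearity is not assumed) such that $d_m(\phi(A),\phi(B))=d_m(A,B)$ for all $A,B\in B_s(H)$. Then there are an operator $U$ on $H$ that is either unitary or antiunitary (i.e. a norm-preserving conjugate-linear bijection of $H$) and a fixed operator $X\in B_s(H)$ such that either \[ \phi(A)=UAU^*+X \quad\text{for all } A\in B_s(H), \] or \[ \phi(A)=-UAU^*+X \quad\text{for all } A\in B_s(H). \] Here, for antiunitary $U$, the adjoint $U^*$ is determined by $\langle U^*x,y\rangle=\langle Uy,x\rangle$ for all $x,y\in H$, so that $U^*=U^{-1}$. -/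

import Mathlib

noncomputable section

/-- `B_s(H)`: the bounded self-adjoint operators (bounded observables) on `H`. -/
abbrev BoundedObservable (H : Type*) [NormedAddCommGroup H] [InnerProductSpace ℂ H]
    [CompleteSpace H] : Type _ :=
  selfAdjoint (H →L[ℂ] H)

/-- The antiunitary operators on `H`: the norm-preserving conjugate-linear bijections of `H`. -/
abbrev AntiunitaryOp (H : Type*) [NormedAddCommGroup H] [InnerProductSpace ℂ H] : Type _ :=
  H ≃ₗᵢ⋆[ℂ] H

section

variable {H : Type*} [NormedAddCommGroup H] [InnerProductSpace ℂ H]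

/-- The mean value `⟨A x, x⟩` of the observable `A` in the pure state given by the unit vector `x`.
(The inner product of Mathlib is linear in its second argument.) -/
def meanValue [CompleteSpace H] (A : BoundedObservable H) (x : H) : ℂ :=
  inner ℂ x ((A : H →L[ℂ] H) x)

/-- The distance `d_m(A, B) = sup_{‖x‖ = 1} |⟨(A - B) x, x⟩|` on observables. -/
def meanDist [CompleteSpace H] (A B : BoundedObservable H) : ℝ :=
  ⨆ x : {x : H // ‖x‖ = 1}, ‖meanValue (A - B) (x : H)‖

lemma norm_meanValue_le [CompleteSpace H] (A : BoundedObservable H) (x : H) (hx : ‖x‖ = 1) :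
    ‖meanValue A x‖ ≤ ‖(A : H →L[ℂ] H)‖ := by
  have h1 := norm_inner_le_norm (𝕜 := ℂ) x ((A : H →L[ℂ] H) x)
  have h2 := (A : H →L[ℂ] H).le_opNorm x
  rw [hx, one_mul] at h1
  rw [hx, mul_one] at h2
  exact h1.trans h2

/-- The supremum defining `d_m` is finite and equals the operator norm of the difference. -/
lemma meanDist_eq_norm [CompleteSpace H] (A B : BoundedObservable H) :
    meanDist A B = ‖(A : H →L[ℂ] H) - (B : H →L[ℂ] H)‖ := by
  have hb : BddAbove (Set.range fun x : {x : H // ‖x‖ = 1} => ‖meanValue (A - B) (x : H)‖) :=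
    ⟨_, by rintro _ ⟨x, rfl⟩; exact norm_meanValue_le (A - B) x x.2⟩
  have h0 : 0 ≤ meanDist A B := Real.iSup_nonneg fun _ => norm_nonneg _
  rw [← AddSubgroupClass.coe_sub]
  refine le_antisymm
    (Real.iSup_le (fun x => norm_meanValue_le (A - B) x x.2) (norm_nonneg _)) ?_
  have hs : ((A - B : BoundedObservable H) : H →L[ℂ] H).IsSymmetric :=
    ContinuousLinearMap.isSelfAdjoint_iff_isSymmetric.mp (A - B).2
  rw [ContinuousLinearMap.norm_eq_iSup_rayleighQuotient _ hs]
  refine ciSup_le fun x => ?_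
  by_cases hx : x = 0
  · subst hx
    simpa using h0
  have hc : ((‖x‖⁻¹ : ℝ) : ℂ) ≠ 0 := by simpa using hx
  have hn : ‖((‖x‖⁻¹ : ℝ) : ℂ) • x‖ = 1 := by
    rw [norm_smul]
    simp [hx]
  rw [← ContinuousLinearMap.rayleigh_smul _ x hc]
  refine le_trans ?_ (le_ciSup hb ⟨_, hn⟩)
  rw [ContinuousLinearMap.rayleighQuotient, hn, one_pow, div_one,
    ContinuousLinearMap.reApplyInnerSelf_apply, inner_re_symm]
  exact Complex.abs_re_le_norm _

/-- The adjoint `U*` of an antiunitary operator. As `U` is norm preserving and bijective this is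
the inverse of `U`; see `AntiunitaryOp.inner_adjoint_left` for its characterization by
`⟨U* x, y⟩ = ⟨U y, x⟩`. -/
def AntiunitaryOp.adjoint (U : AntiunitaryOp H) : AntiunitaryOp H :=
  LinearIsometryEquiv.symm U

lemma AntiunitaryOp.inner_map_map (U : AntiunitaryOp H) (x y : H) :
    inner ℂ (U x) (U y) = inner ℂ y x := by
  have hre : ∀ (a b : H), RCLike.re (inner ℂ (U a) (U b)) = RCLike.re (inner ℂ a b) := by
    intro a b
    rw [re_inner_eq_norm_add_mul_self_sub_norm_mul_self_sub_norm_mul_self_div_two,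
      re_inner_eq_norm_add_mul_self_sub_norm_mul_self_sub_norm_mul_self_div_two,
      ← map_add, LinearIsometryEquiv.norm_map, LinearIsometryEquiv.norm_map,
      LinearIsometryEquiv.norm_map]
  have h1 := hre x y
  have h2 := hre x (Complex.I • y)
  rw [LinearIsometryEquiv.map_smulₛₗ] at h2
  simp only [inner_smul_right, Complex.conj_I] at h2
  have h3 : (inner ℂ y x : ℂ).re = (inner ℂ x y : ℂ).re := inner_re_symm (𝕜 := ℂ) y x
  have h4 : (inner ℂ y x : ℂ).im = -(inner ℂ x y : ℂ).im := inner_im_symm (𝕜 := ℂ) y x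
  apply Complex.ext
  · rw [h3]
    exact h1
  · rw [h4]
    simpa using h2

lemma AntiunitaryOp.inner_adjoint_left (U : AntiunitaryOp H) (x y : H) :
    inner ℂ (U.adjoint x) y = inner ℂ (U y) x := by
  have h := AntiunitaryOp.inner_map_map U y (U.adjoint x)
  rw [← h, AntiunitaryOp.adjoint, LinearIsometryEquiv.apply_symm_apply]

/-- The (complex-linear, bounded) operator `U A U*` for an antiunitary operator `U`. -/
def AntiunitaryOp.conj (U : AntiunitaryOp H) (A : H →L[ℂ] H) : H →L[ℂ] H :=
  (LinearIsometryEquiv.toContinuousLinearEquiv U : H →L⋆[ℂ] H).comp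
    (A.comp (LinearIsometryEquiv.toContinuousLinearEquiv U.adjoint : H →L⋆[ℂ] H))

@[simp] lemma AntiunitaryOp.conj_apply (U : AntiunitaryOp H) (A : H →L[ℂ] H) (x : H) :
    U.conj A x = U (A (U.adjoint x)) := rfl

end

end

/-! By Mazur–Ulam, `φ` is a translate of a surjective real-linear isometry `T`. For `H ≠ 0` the norm
singles out `±1`: they are the `A` in the unit ball with `‖B‖ + 1 ≤ max ‖B + A‖ ‖B - A‖` for all
`B`. Hence `T 1 = ±1` (`map_one_eq_or`), and passing to `-T` if necessary makes `T` unital.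

A unital isometry preserves positivity (`nonneg_map_iff`), hence the extreme rays of the positive
cone, which are spanned by the rank-one observables. If `|x⟩⟨x|` goes to `|y⟩⟨y|`, then `⟨T A y, y⟩
= ⟨A x, x⟩` for every `A` (`quadForm_map`); in particular transition probabilities are preserved.

A Wigner-type argument, shortened by the linearity of `T`, now produces `U`. For a unit vector `e`
with `|e⟩⟨e|` going to `|e'⟩⟨e'|`, the images of `|e⟩⟨x| + |x⟩⟨e|` define a map on vectors that is
linear or conjugate-linear (`offDiag_semilinear`); together with `e ↦ e'` it gives `U`. Equality of
quadratic forms then yields `T A = U A U*`. -/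

noncomputable section

namespace BoundedObservable

/-- Two additive maps that agree up to a sign at each point agree up to one global sign. -/
lemma eq_or_eq_neg_of_forall {G : Type*} [AddCommGroup G] {J K : G → G} (hJ : ∀ x y, J (x + y) = J x + J y)
    (hK : ∀ x y, K (x + y) = K x + K y) (h : ∀ x, J x = K x ∨ J x = -K x) :
    (∀ x, J x = K x) ∨ (∀ x, J x = -K x) := by
  by_contra! hcon
  obtain ⟨⟨x, hx⟩, y, hy⟩ := hcon
  have hx' := (h x).resolve_left hx
  have hy' := (h y).resolve_right hy
  rcases h (x + y) with h1 | h1 <;> rw [hJ, hK, hx', hy'] at h1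
  · apply hx
    rw [hx']
    exact add_right_cancel h1
  · apply hy
    rw [hy']
    rw [neg_add] at h1
    exact add_left_cancel h1

variable {H : Type*} [NormedAddCommGroup H] [InnerProductSpace ℂ H]

lemma exists_phase_smul_inner_eq (x y : H) :
    ∃ c : ℂ, ‖c‖ = 1 ∧ (inner ℂ x (c • y) : ℂ) = ‖(inner ℂ x y : ℂ)‖ := by
  obtain ⟨c, hc, h⟩ := RCLike.exists_norm_eq_mul_self (inner ℂ x y : ℂ)
  exact ⟨c, hc, by rw [inner_smul_right]; exact h.symm⟩

lemma inner_self_of_norm_eq_one {e : H} (he : ‖e‖ = 1) : (inner ℂ e e : ℂ) = 1 := by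
  rw [inner_self_eq_norm_sq_to_K, he]
  simp

lemma inner_sub_inner_smul_self (he : ‖e‖ = 1) (x : H) :
    (inner ℂ e (x - (inner ℂ e x : ℂ) • e) : ℂ) = 0 := by
  rw [inner_sub_right, inner_smul_right, inner_self_of_norm_eq_one he, mul_one, sub_self]

variable [CompleteSpace H]

/-! ### Quadratic forms of observables. -/

instance instNormedSpaceReal : NormedSpace ℝ (BoundedObservable H) where
  norm_smul_le c A := norm_smul_le c (A : H →L[ℂ] H)

lemma coe_real_smul_apply (c : ℝ) (A : BoundedObservable H) (x : H) :
    ((c • A : BoundedObservable H) : H →L[ℂ] H) x = (c : ℂ) • (A : H →L[ℂ] H) x := rfl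

lemma inner_apply_left (A : BoundedObservable H) (x y : H) :
    inner ℂ ((A : H →L[ℂ] H) x) y = inner ℂ x ((A : H →L[ℂ] H) y) :=
  ContinuousLinearMap.isSelfAdjoint_iff_isSymmetric.mp A.2 x y

/-- The real quadratic form `⟨A x, x⟩` of an observable. -/
def quadForm (A : BoundedObservable H) (x : H) : ℝ := (inner ℂ x ((A : H →L[ℂ] H) x)).re

lemma inner_self_apply (A : BoundedObservable H) (x : H) :
    inner ℂ x ((A : H →L[ℂ] H) x) = (quadForm A x : ℂ) := by
  apply Complex.ext
  · rfl
  · have h := congrArg Complex.im (inner_conj_symm (𝕜 := ℂ) x ((A : H →L[ℂ] H) x))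
    rw [inner_apply_left, Complex.conj_im] at h
    simp only [Complex.ofReal_im]
    linarith

lemma quadForm_add (A B : BoundedObservable H) (x : H) :
    quadForm (A + B) x = quadForm A x + quadForm B x := by
  simp [quadForm]

lemma quadForm_sub (A B : BoundedObservable H) (x : H) :
    quadForm (A - B) x = quadForm A x - quadForm B x := by
  simp [quadForm]

lemma quadForm_neg (A : BoundedObservable H) (x : H) : quadForm (-A) x = -quadForm A x := by
  simp [quadForm]

lemma quadForm_real_smul (c : ℝ) (A : BoundedObservable H) (x : H) :
    quadForm (c • A) x = c * quadForm A x := by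
  rw [quadForm, coe_real_smul_apply, inner_smul_right, Complex.re_ofReal_mul, quadForm]

lemma quadForm_one (x : H) : quadForm (1 : BoundedObservable H) x = ‖x‖ ^ 2 := by
  have := inner_self_eq_norm_sq (𝕜 := ℂ) x
  simpa [quadForm] using this

lemma quadForm_smul (A : BoundedObservable H) (c : ℂ) (x : H) :
    quadForm A (c • x) = ‖c‖ ^ 2 * quadForm A x := by
  have h := inner_self_apply A (c • x)
  rw [map_smul, inner_smul_left, inner_smul_right, inner_self_apply, ← mul_assoc,
    Complex.conj_mul'] at h
  exact_mod_cast h.symm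

lemma quadForm_add_vec (A : BoundedObservable H) (x y : H) :
    quadForm A (x + y) =
      quadForm A x + 2 * (inner ℂ x ((A : H →L[ℂ] H) y)).re + quadForm A y := by
  have h : (inner ℂ y ((A : H →L[ℂ] H) x)).re = (inner ℂ x ((A : H →L[ℂ] H) y)).re := by
    rw [← inner_apply_left]
    exact inner_re_symm (𝕜 := ℂ) _ _
  simp only [quadForm, map_add, inner_add_left, inner_add_right, Complex.add_re, h]
  ring

lemma abs_quadForm_le (A : BoundedObservable H) (x : H) : |quadForm A x| ≤ ‖A‖ * ‖x‖ ^ 2 := by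
  calc |quadForm A x| ≤ ‖inner ℂ x ((A : H →L[ℂ] H) x)‖ := Complex.abs_re_le_norm _
    _ ≤ ‖x‖ * ‖(A : H →L[ℂ] H) x‖ := norm_inner_le_norm _ _
    _ ≤ ‖x‖ * (‖A‖ * ‖x‖) := by
      gcongr
      exact (A : H →L[ℂ] H).le_opNorm x
    _ = ‖A‖ * ‖x‖ ^ 2 := by ring

lemma norm_le_of_abs_quadForm_le (A : BoundedObservable H) {c : ℝ} (hc : 0 ≤ c)
    (h : ∀ x, ‖x‖ = 1 → |quadForm A x| ≤ c) : ‖A‖ ≤ c := by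
  have h0 := meanDist_eq_norm A 0
  have : ‖A‖ = meanDist A 0 := by rw [h0]; simp
  rw [this]
  refine Real.iSup_le (fun x => ?_) hc
  rw [sub_zero, meanValue, inner_self_apply, Complex.norm_real]
  exact h x x.2

lemma ext_quadForm {A B : BoundedObservable H} (h : ∀ x, quadForm A x = quadForm B x) :
    A = B := by
  rw [← sub_eq_zero, ← norm_le_zero_iff]
  refine norm_le_of_abs_quadForm_le _ le_rfl fun x _ => ?_
  rw [quadForm_sub, h, sub_self, abs_zero]

/-! ### The positive cone. -/

/-- Positivity of an observable, through its quadratic form. -/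
def Nonneg (A : BoundedObservable H) : Prop := ∀ x, 0 ≤ quadForm A x

/-- Positivity is expressed by the norm and `1` alone, so unital linear isometries preserve it. -/
lemma nonneg_iff_norm_sub_le (A : BoundedObservable H) :
    Nonneg A ↔ ‖‖A‖ • (1 : BoundedObservable H) - A‖ ≤ ‖A‖ := by
  constructor
  · intro h
    refine norm_le_of_abs_quadForm_le _ (norm_nonneg _) fun x hx => ?_
    have h1 := abs_le.mp (abs_quadForm_le A x)
    rw [quadForm_sub, quadForm_real_smul, quadForm_one, abs_le]
    rw [hx] at *
    constructor <;> linarith [h x]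
  · intro h x
    have h1 := abs_le.mp (abs_quadForm_le (‖A‖ • (1 : BoundedObservable H) - A) x)
    rw [quadForm_sub, quadForm_real_smul, quadForm_one] at h1
    have := mul_le_mul_of_nonneg_right h (sq_nonneg ‖x‖)
    linarith

/-- The Cauchy–Schwarz inequality for the form of a positive observable. -/
lemma Nonneg.norm_inner_sq_le {A : BoundedObservable H} (hA : Nonneg A) (u v : H) :
    ‖inner ℂ u ((A : H →L[ℂ] H) v)‖ ^ 2 ≤ quadForm A u * quadForm A v := by
  set c : ℂ := inner ℂ u ((A : H →L[ℂ] H) v) with hc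
  have key : ∀ s : ℝ,
      0 ≤ (‖c‖ ^ 2 * quadForm A v) * (s * s) + (2 * ‖c‖ ^ 2) * s + quadForm A u := by
    intro s
    -- The factor `conj c` makes the cross term the real number `s * ‖c‖ ^ 2`.
    have h := hA (u + ((s : ℂ) * (starRingEnd ℂ) c) • v)
    rw [quadForm_add_vec, quadForm_smul, map_smul, inner_smul_right, ← hc, mul_assoc,
      RCLike.conj_mul, norm_mul, RCLike.norm_conj, Complex.norm_real, Real.norm_eq_abs,
      mul_pow, sq_abs] at h
    have e : (((s : ℂ) * ((‖c‖ : ℂ)) ^ 2).re) = s * ‖c‖ ^ 2 := by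
      exact_mod_cast Complex.ofReal_re _
    simp only [Complex.coe_algebraMap] at h
    rw [e] at h
    linarith
  have h := discrim_le_zero key
  rw [discrim] at h
  by_cases h0 : ‖c‖ = 0
  · rw [h0]
    simpa using mul_nonneg (hA u) (hA v)
  · have : 0 < ‖c‖ ^ 2 := by positivity
    by_contra! hlt
    nlinarith [mul_lt_mul_of_pos_left hlt this]

lemma Nonneg.apply_eq_zero {A : BoundedObservable H} (hA : Nonneg A) {v : H}
    (hv : quadForm A v = 0) : (A : H →L[ℂ] H) v = 0 := by
  have h := hA.norm_inner_sq_le ((A : H →L[ℂ] H) v) v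
  rw [hv, mul_zero] at h
  have h2 : ‖inner ℂ ((A : H →L[ℂ] H) v) ((A : H →L[ℂ] H) v)‖ = 0 := by
    nlinarith [norm_nonneg (inner ℂ ((A : H →L[ℂ] H) v) ((A : H →L[ℂ] H) v))]
  simpa using h2

/-! ### Rank-one observables and extreme rays. -/

/-- The rank-one observable `|x⟩⟨x|`. -/
def rankOneSelf (x : H) : BoundedObservable H :=
  ⟨InnerProductSpace.rankOne ℂ x x,
    (InnerProductSpace.isPositive_rankOne_self x).isSelfAdjoint⟩

lemma rankOneSelf_apply (x z : H) :
    ((rankOneSelf x : BoundedObservable H) : H →L[ℂ] H) z = (inner ℂ x z : ℂ) • x := rfl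

lemma quadForm_rankOneSelf (x z : H) : quadForm (rankOneSelf x) z = ‖(inner ℂ x z : ℂ)‖ ^ 2 := by
  have h := inner_self_apply (rankOneSelf x) z
  rw [rankOneSelf_apply, inner_smul_right, ← inner_conj_symm z x, Complex.mul_conj'] at h
  exact_mod_cast h.symm

lemma nonneg_rankOneSelf (x : H) : Nonneg (rankOneSelf x) := fun z => by
  rw [quadForm_rankOneSelf]
  positivity

lemma norm_rankOneSelf (x : H) : ‖rankOneSelf x‖ = ‖x‖ ^ 2 := by
  rw [sq]
  exact InnerProductSpace.norm_rankOne (𝕜 := ℂ) x x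

lemma rankOneSelf_smul (c : ℂ) (x : H) :
    rankOneSelf (c • x) = (‖c‖ ^ 2) • rankOneSelf x := by
  refine ext_quadForm fun z => ?_
  rw [quadForm_real_smul, quadForm_rankOneSelf, quadForm_rankOneSelf, inner_smul_left, norm_mul,
    RCLike.norm_conj]
  ring

lemma rankOneSelf_zero : rankOneSelf (0 : H) = 0 :=
  ext_quadForm fun z => by simp [quadForm, rankOneSelf_apply]

/-- Vectors with the same rank-one observable differ by a phase. -/
lemma exists_phase_of_rankOneSelf_eq {x y : H} (h : rankOneSelf x = rankOneSelf y) :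
    ∃ c : ℂ, ‖c‖ = 1 ∧ x = c • y := by
  have hn : ‖x‖ = ‖y‖ := by
    have h1 := congrArg norm h
    rw [norm_rankOneSelf, norm_rankOneSelf] at h1
    exact (sq_eq_sq₀ (norm_nonneg _) (norm_nonneg _)).mp h1
  by_cases hx : x = 0
  · subst hx
    have : y = 0 := by simpa using hn.symm
    exact ⟨1, by simp, by simp [this]⟩
  have hx0 : ‖x‖ ≠ 0 := norm_ne_zero_iff.mpr hx
  have h2 : (inner ℂ x x : ℂ) • x = (inner ℂ y x : ℂ) • y := by
    rw [← rankOneSelf_apply, h, rankOneSelf_apply]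
  have hxx : (inner ℂ x x : ℂ) ≠ 0 := inner_self_ne_zero.mpr hx
  have h3 : x = ((inner ℂ x x : ℂ)⁻¹ * inner ℂ y x) • y := by
    rw [mul_smul, ← h2, smul_smul, inv_mul_cancel₀ hxx, one_smul]
  refine ⟨_, ?_, h3⟩
  have h4 := congrArg norm h3
  rw [norm_smul, ← hn] at h4
  exact mul_right_cancel₀ hx0 (by rw [one_mul]; exact h4.symm)

/-- An observable spans an extreme ray of the positive cone. -/
def IsExtremeRay (A : BoundedObservable H) : Prop :=
  Nonneg A ∧ ∀ B, Nonneg B → Nonneg (A - B) → ∃ t : ℝ, B = t • A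

/-- If `0 ≤ B ≤ |x⟩⟨x|`, the form of `B` vanishes on `x^⊥`, hence so does `B`; its form is then
determined by its value at `x`. -/
lemma isExtremeRay_rankOneSelf (x : H) : IsExtremeRay (rankOneSelf x) := by
  refine ⟨nonneg_rankOneSelf x, fun B hB hAB => ?_⟩
  have hperp : ∀ v, (inner ℂ x v : ℂ) = 0 → (B : H →L[ℂ] H) v = 0 := by
    intro v hv
    apply hB.apply_eq_zero
    have h1 := hAB v
    rw [quadForm_sub, quadForm_rankOneSelf, hv, norm_zero] at h1
    linarith [hB v]
  by_cases hx : x = 0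
  · refine ⟨0, ext_quadForm fun v => ?_⟩
    rw [quadForm_real_smul, zero_mul, quadForm, hperp v (by simp [hx])]
    simp
  have hxx : (inner ℂ x x : ℂ) ≠ 0 := inner_self_ne_zero.mpr hx
  refine ⟨quadForm B x / ‖x‖ ^ 4, ext_quadForm fun v => ?_⟩
  set c : ℂ := (inner ℂ x v) / (inner ℂ x x) with hc
  have hw : (inner ℂ x (v - c • x) : ℂ) = 0 := by
    rw [inner_sub_right, inner_smul_right, hc, div_mul_cancel₀ _ hxx, sub_self]
  have hv : v = c • x + (v - c • x) := by abel
  have hBw := hperp _ hw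
  have hnc : ‖c‖ ^ 2 = ‖(inner ℂ x v : ℂ)‖ ^ 2 / ‖x‖ ^ 4 := by
    rw [hc, norm_div, inner_self_eq_norm_sq_to_K, norm_pow]
    simp only [Complex.coe_algebraMap, Complex.norm_real, norm_norm]
    rw [div_pow]
    ring
  rw [quadForm_real_smul, quadForm_rankOneSelf]
  conv_lhs => rw [hv]
  rw [quadForm_add_vec, hBw, inner_zero_right, quadForm_smul, hnc]
  simp only [quadForm, hBw, inner_zero_right, Complex.zero_re]
  ring

/-- Cauchy–Schwarz says that `|A u⟩⟨A u| / ⟨A u, u⟩ ≤ A`, and extremality makes the two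
proportional. The case `A = 0` is covered by `x = 0`. -/
lemma IsExtremeRay.exists_eq_rankOneSelf {A : BoundedObservable H} (hA : IsExtremeRay A) :
    ∃ x, A = rankOneSelf x := by
  obtain ⟨hA0, hA1⟩ := hA
  by_cases h : ∀ u, (A : H →L[ℂ] H) u = 0
  · refine ⟨0, ext_quadForm fun v => ?_⟩
    rw [rankOneSelf_zero]
    simp [quadForm, h]
  push Not at h
  obtain ⟨u, hu⟩ := h
  have hq : 0 < quadForm A u := (hA0 u).lt_of_ne fun h0 => hu (hA0.apply_eq_zero h0.symm)
  obtain ⟨t, ht⟩ := hA1 ((quadForm A u)⁻¹ • rankOneSelf ((A : H →L[ℂ] H) u))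
    (fun z => by
      rw [quadForm_real_smul]
      exact mul_nonneg (inv_nonneg.mpr hq.le) (nonneg_rankOneSelf _ z))
    (fun z => by
      rw [quadForm_sub, quadForm_real_smul, quadForm_rankOneSelf, inner_apply_left, sub_nonneg,
        inv_mul_le_iff₀ hq]
      exact hA0.norm_inner_sq_le u z)
  have ht' : ∀ z, (quadForm A u)⁻¹ * ‖(inner ℂ ((A : H →L[ℂ] H) u) z : ℂ)‖ ^ 2
      = t * quadForm A z := fun z => by
    rw [← quadForm_rankOneSelf, ← quadForm_real_smul, ht, quadForm_real_smul]
  have hpos : 0 < t := by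
    have h1 := ht' u
    rw [inner_apply_left, inner_self_apply, Complex.norm_real, Real.norm_eq_abs, sq_abs] at h1
    have h2 : 0 < t * quadForm A u := by rw [← h1]; positivity
    exact pos_of_mul_pos_left h2 hq.le
  refine ⟨((√(t⁻¹ * (quadForm A u)⁻¹) : ℝ) : ℂ) • (A : H →L[ℂ] H) u, ext_quadForm fun z => ?_⟩
  rw [rankOneSelf_smul, quadForm_real_smul, quadForm_rankOneSelf, Complex.norm_real,
    Real.norm_eq_abs, sq_abs, Real.sq_sqrt (by positivity), mul_assoc, ht']
  field_simp

/-! ### Metric characterization of `±1`. -/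

/-- Both forms must be almost `1` at a common unit vector `z`; then `z` is close to `x` up to a
phase and `A z` is close to `z`. The supremum need not be attained, hence the `ε`. -/
lemma apply_eq_self_of_two_le_norm {A : BoundedObservable H} (hA : ‖A‖ ≤ 1) {x : H}
    (hx : ‖x‖ = 1) (h : 2 ≤ ‖rankOneSelf x + A‖) : (A : H →L[ℂ] H) x = x := by
  have hAle : ∀ v, ‖(A : H →L[ℂ] H) v‖ ≤ ‖v‖ := fun v =>
    ((A : H →L[ℂ] H).le_opNorm v).trans (mul_le_of_le_one_left (norm_nonneg _) hA)
  -- With `a ^ 2 ≤ ε` and `b ^ 2 ≤ 2 * ε` below, `(2 * a + b) ^ 2 ≤ 2 * (4 * a ^ 2 + b ^ 2) ≤ 12 *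
  -- ε`.
  have key : ∀ ε : ℝ, 0 < ε → ε < 1 → ‖(A : H →L[ℂ] H) x - x‖ ^ 2 ≤ 12 * ε := by
    intro ε hε hε1
    obtain ⟨z, hz, hz2⟩ : ∃ z, ‖z‖ = 1 ∧ 2 - ε < |quadForm (rankOneSelf x + A) z| := by
      by_contra! hcon
      have := norm_le_of_abs_quadForm_le _ (by linarith) hcon
      linarith
    have hAz := abs_le.mp (abs_quadForm_le A z)
    have hQz := abs_le.mp (abs_quadForm_le (rankOneSelf x) z)
    rw [hz] at hAz hQz
    rw [norm_rankOneSelf, hx] at hQz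
    have hQ0 := nonneg_rankOneSelf x z
    rw [quadForm_add] at hz2
    -- The negative sign is excluded: the sum is at least `-1`, and `ε < 1`.
    have hz3 : 2 - ε < quadForm (rankOneSelf x) z + quadForm A z := by
      rcases lt_abs.mp hz2 with h1 | h1 <;> linarith
    have h1 : ‖(A : H →L[ℂ] H) z - z‖ ^ 2 ≤ 2 * ε := by
      have e := norm_sub_sq (𝕜 := ℂ) z ((A : H →L[ℂ] H) z)
      have e2 : RCLike.re (inner ℂ z ((A : H →L[ℂ] H) z)) = quadForm A z := rfl
      have e3 := hAle z
      rw [norm_sub_rev, e, e2, hz]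
      rw [hz] at e3
      nlinarith [norm_nonneg ((A : H →L[ℂ] H) z)]
    set c : ℂ := inner ℂ z x with hc
    have hcx : quadForm (rankOneSelf x) z = ‖c‖ ^ 2 := by
      rw [quadForm_rankOneSelf, hc, ← inner_conj_symm, RCLike.norm_conj]
    have h2 : ‖x - c • z‖ ^ 2 ≤ ε := by
      rw [norm_sub_sq (𝕜 := ℂ), inner_smul_right, ← inner_conj_symm x z, ← hc,
        Complex.mul_conj', norm_smul, hx, hz]
      have : RCLike.re (((‖c‖ : ℂ)) ^ 2) = ‖c‖ ^ 2 := by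
        rw [← Complex.ofReal_pow]
        exact Complex.ofReal_re _
      rw [this]
      nlinarith
    have hc1 : ‖c‖ ≤ 1 := by
      have := norm_inner_le_norm (𝕜 := ℂ) z x
      rwa [hx, hz, one_mul] at this
    have h3 : (A : H →L[ℂ] H) x - x =
        (A : H →L[ℂ] H) (x - c • z) - (x - c • z) + c • ((A : H →L[ℂ] H) z - z) := by
      rw [map_sub, map_smul, smul_sub]
      abel
    have h4 : ‖(A : H →L[ℂ] H) x - x‖ ≤ 2 * ‖x - c • z‖ + ‖(A : H →L[ℂ] H) z - z‖ := by
      rw [h3]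
      refine (norm_add_le _ _).trans (add_le_add ?_ ?_)
      · refine (norm_sub_le _ _).trans ?_
        linarith [hAle (x - c • z)]
      · rw [norm_smul]
        exact mul_le_of_le_one_left (norm_nonneg _) hc1
    nlinarith [norm_nonneg ((A : H →L[ℂ] H) x - x), norm_nonneg (x - c • z),
      norm_nonneg ((A : H →L[ℂ] H) z - z),
      sq_nonneg (2 * ‖x - c • z‖ - ‖(A : H →L[ℂ] H) z - z‖)]
  by_contra hne
  have hpos : 0 < ‖(A : H →L[ℂ] H) x - x‖ ^ 2 := by
    have : 0 < ‖(A : H →L[ℂ] H) x - x‖ := norm_pos_iff.mpr (sub_ne_zero.mpr hne)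
    positivity
  have hmin : 0 < min (1 / 2) (‖(A : H →L[ℂ] H) x - x‖ ^ 2 / 24) := by positivity
  have h1 := key _ hmin (lt_of_le_of_lt (min_le_left _ _) (by norm_num))
  have h2 := min_le_right (1 / 2 : ℝ) (‖(A : H →L[ℂ] H) x - x‖ ^ 2 / 24)
  linarith

lemma norm_one_eq [Nontrivial H] : ‖(1 : BoundedObservable H)‖ = 1 := by
  have : ‖(1 : H →L[ℂ] H)‖ = 1 := norm_one
  exact this

lemma norm_add_one_le_max [Nontrivial H] (B : BoundedObservable H) :
    ‖B‖ + 1 ≤ max ‖B + 1‖ ‖B - 1‖ := by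
  have key : ∀ x : H, ‖x‖ = 1 → |quadForm B x| + 1 ≤ max ‖B + 1‖ ‖B - 1‖ := by
    intro x hx
    have h1 := abs_le.mp (abs_quadForm_le (B + 1) x)
    have h2 := abs_le.mp (abs_quadForm_le (B - 1) x)
    rw [quadForm_add, quadForm_one, hx] at h1
    rw [quadForm_sub, quadForm_one, hx] at h2
    rcases abs_cases (quadForm B x) with h | h
    · exact le_max_of_le_left (by linarith)
    · exact le_max_of_le_right (by linarith)
  obtain ⟨x, hx⟩ := exists_norm_eq H (zero_le_one (α := ℝ))
  have h0 := key x hx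
  have h1 := norm_le_of_abs_quadForm_le B (c := max ‖B + 1‖ ‖B - 1‖ - 1)
    (by linarith [abs_nonneg (quadForm B x)]) fun y hy => by linarith [key y hy]
  linarith

/-- Testing on `B = |x⟩⟨x|` shows `A x = ±x` for each unit vector `x`; additivity makes the sign
global. -/
lemma eq_one_or_eq_neg_one_of_norm_add_one_le_max {A : BoundedObservable H} (hA : ‖A‖ ≤ 1)
    (h : ∀ B : BoundedObservable H, ‖B‖ + 1 ≤ max ‖B + A‖ ‖B - A‖) : A = 1 ∨ A = -1 := by
  have hunit : ∀ x : H, ‖x‖ = 1 → (A : H →L[ℂ] H) x = x ∨ (A : H →L[ℂ] H) x = -x := by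
    intro x hx
    have h1 := h (rankOneSelf x)
    rw [norm_rankOneSelf, hx] at h1
    rcases le_max_iff.mp h1 with h2 | h2
    · exact Or.inl (apply_eq_self_of_two_le_norm hA hx (by linarith))
    · right
      rw [sub_eq_add_neg] at h2
      have h3 := apply_eq_self_of_two_le_norm (A := -A) (by rwa [norm_neg]) hx (by linarith)
      rw [AddSubgroup.coe_neg, neg_apply] at h3
      exact neg_eq_iff_eq_neg.mp h3
  have hall : ∀ x : H, (A : H →L[ℂ] H) x = id x ∨ (A : H →L[ℂ] H) x = -id x := by
    intro x
    by_cases hx : x = 0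
    · simp [hx]
    have hx0 : (‖x‖ : ℂ) ≠ 0 := by simpa using hx
    have hn : ‖((‖x‖ : ℂ))⁻¹ • x‖ = 1 := by
      rw [norm_smul, norm_inv, Complex.norm_real, norm_norm,
        inv_mul_cancel₀ (norm_ne_zero_iff.mpr hx)]
    have hinv : (((‖x‖ : ℂ))⁻¹) ≠ 0 := inv_ne_zero hx0
    refine (hunit _ hn).imp (fun h1 => ?_) (fun h1 => ?_)
    · rw [map_smul] at h1
      exact smul_right_injective H hinv h1
    · rw [map_smul, ← smul_neg] at h1
      exact smul_right_injective H hinv h1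
  refine (eq_or_eq_neg_of_forall (fun x y => map_add _ x y) (fun _ _ => rfl) hall).imp
    (fun h1 => ?_) (fun h1 => ?_)
  · exact Subtype.ext (ContinuousLinearMap.ext h1)
  · exact Subtype.ext (ContinuousLinearMap.ext h1)

lemma map_one_eq_or [Nontrivial H] (T : BoundedObservable H ≃ₗᵢ[ℝ] BoundedObservable H) :
    T 1 = 1 ∨ T 1 = -1 := by
  refine eq_one_or_eq_neg_one_of_norm_add_one_le_max (by rw [T.norm_map, norm_one_eq]) fun B => ?_
  have h := norm_add_one_le_max (T.symm B)
  rw [← T.norm_map (T.symm B + 1), ← T.norm_map (T.symm B - 1), T.map_add, T.map_sub,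
    T.apply_symm_apply, T.symm.norm_map] at h
  exact h

/-! ### Unital isometries: order, rank-one observables, quadratic forms. -/

section Unital

variable {T : BoundedObservable H ≃ₗᵢ[ℝ] BoundedObservable H}

lemma symm_map_one (hT : T 1 = 1) : T.symm 1 = 1 := by
  rw [LinearIsometryEquiv.symm_apply_eq, hT]

lemma nonneg_map_iff (hT : T 1 = 1) (A : BoundedObservable H) : Nonneg (T A) ↔ Nonneg A := by
  rw [nonneg_iff_norm_sub_le, nonneg_iff_norm_sub_le, T.norm_map]
  nth_rw 1 [← hT]
  rw [← T.map_smul, ← T.map_sub, T.norm_map]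

lemma IsExtremeRay.map (hT : T 1 = 1) {A : BoundedObservable H} (hA : IsExtremeRay A) :
    IsExtremeRay (T A) := by
  refine ⟨(nonneg_map_iff hT A).mpr hA.1, fun B hB hAB => ?_⟩
  obtain ⟨t, ht⟩ := hA.2 (T.symm B) ((nonneg_map_iff (symm_map_one hT) B).mpr hB)
    (by rwa [← nonneg_map_iff hT, T.map_sub, T.apply_symm_apply])
  refine ⟨t, ?_⟩
  rw [← map_smul, ← ht, T.apply_symm_apply]

lemma exists_map_rankOneSelf (hT : T 1 = 1) (x : H) :
    ∃ y, T (rankOneSelf x) = rankOneSelf y :=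
  ((isExtremeRay_rankOneSelf x).map hT).exists_eq_rankOneSelf

lemma norm_eq_of_map_rankOneSelf {x y : H} (h : T (rankOneSelf x) = rankOneSelf y) :
    ‖y‖ = ‖x‖ := by
  have h1 := congrArg norm h
  rw [T.norm_map, norm_rankOneSelf, norm_rankOneSelf] at h1
  exact ((sq_eq_sq₀ (norm_nonneg _) (norm_nonneg _)).mp h1).symm

/-- `A` lies below `(⟨A x, x⟩ + ε) P + t (1 - P)` for large `t`, where `P = |x⟩⟨x|`. -/
lemma exists_nonneg_sub (A : BoundedObservable H) {x : H} (hx : ‖x‖ = 1) {ε : ℝ} (hε : 0 < ε) :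
    ∃ t : ℝ, Nonneg ((quadForm A x + ε) • rankOneSelf x + t • (1 - rankOneSelf x) - A) := by
  -- On `w ⊥ x`, the summand `‖A‖` bounds the form of `A`; `‖A‖ ^ 2 / ε` and the spare `ε` on `x`
  -- absorb the cross term by AM–GM.
  refine ⟨‖A‖ ^ 2 / ε + ‖A‖, fun z => ?_⟩
  set c : ℂ := inner ℂ x z with hc
  set w := z - c • x with hw
  have hz : z = c • x + w := by rw [hw]; abel
  have hxw : (inner ℂ x w : ℂ) = 0 := by
    rw [hw, inner_sub_right, inner_smul_right, inner_self_eq_norm_sq_to_K, hx, ← hc]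
    simp
  have hn : ‖z‖ ^ 2 = ‖c‖ ^ 2 + ‖w‖ ^ 2 := by
    have h1 : (inner ℂ (c • x) w : ℂ) = 0 := by rw [inner_smul_left, hxw, mul_zero]
    have h2 := norm_add_sq_eq_norm_sq_add_norm_sq_of_inner_eq_zero (c • x) w h1
    rw [← hz, norm_smul, hx, mul_one] at h2
    linarith
  have hAz : quadForm A z =
      ‖c‖ ^ 2 * quadForm A x + 2 * (inner ℂ (c • x) ((A : H →L[ℂ] H) w)).re + quadForm A w := by
    conv_lhs => rw [hz]
    rw [quadForm_add_vec, quadForm_smul]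
  have hcross : (inner ℂ (c • x) ((A : H →L[ℂ] H) w)).re ≤ ‖c‖ * (‖A‖ * ‖w‖) := by
    refine (Complex.re_le_norm _).trans ((norm_inner_le_norm _ _).trans ?_)
    rw [norm_smul, hx, mul_one]
    gcongr
    exact (A : H →L[ℂ] H).le_opNorm w
  have hAw := (abs_le.mp (abs_quadForm_le A w)).2
  rw [quadForm_sub, quadForm_add, quadForm_real_smul, quadForm_real_smul, quadForm_sub,
    quadForm_one, quadForm_rankOneSelf, ← hc, hn, hAz]
  have hsq : 2 * (‖c‖ * (‖A‖ * ‖w‖)) ≤ ε * ‖c‖ ^ 2 + ‖A‖ ^ 2 / ε * ‖w‖ ^ 2 := by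
    have e : ε * ‖c‖ ^ 2 + ‖A‖ ^ 2 / ε * ‖w‖ ^ 2 - 2 * (‖c‖ * (‖A‖ * ‖w‖)) =
        (ε * ‖c‖ - ‖A‖ * ‖w‖) ^ 2 / ε := by
      field_simp
      ring
    have : 0 ≤ (ε * ‖c‖ - ‖A‖ * ‖w‖) ^ 2 / ε := by positivity
    linarith
  nlinarith

lemma quadForm_map_le (hT : T 1 = 1) {x y : H} (hx : ‖x‖ = 1)
    (h : T (rankOneSelf x) = rankOneSelf y) (A : BoundedObservable H) :
    quadForm (T A) y ≤ quadForm A x := by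
  have hy : ‖y‖ = 1 := by rw [norm_eq_of_map_rankOneSelf h, hx]
  refine le_of_forall_pos_le_add fun ε hε => ?_
  obtain ⟨t, ht⟩ := exists_nonneg_sub A hx hε
  -- The form of `1 - |y⟩⟨y|` vanishes at `y`, so the uncontrolled `t` drops out.
  have h1 := (nonneg_map_iff hT _).mpr ht y
  rw [T.map_sub, T.map_add, T.map_smul, T.map_smul, T.map_sub, hT, h, quadForm_sub, quadForm_add,
    quadForm_real_smul, quadForm_real_smul, quadForm_sub, quadForm_one, quadForm_rankOneSelf,
    inner_self_eq_norm_sq_to_K, hy] at h1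
  simp only [Complex.coe_algebraMap, Complex.ofReal_one, one_pow, norm_one] at h1
  linarith

lemma quadForm_map (hT : T 1 = 1) {x y : H} (h : T (rankOneSelf x) = rankOneSelf y)
    (A : BoundedObservable H) : quadForm (T A) y = quadForm A x := by
  have hn := norm_eq_of_map_rankOneSelf h
  by_cases hx : x = 0
  · have hy : y = 0 := by rwa [hx, norm_zero, norm_eq_zero] at hn
    simp [hx, hy, quadForm]
  set c : ℂ := ((‖x‖ : ℂ))⁻¹ with hc
  have hx0 := norm_ne_zero_iff.mpr hx
  have hnc : ‖c‖ = ‖x‖⁻¹ := by rw [hc, norm_inv, Complex.norm_real, norm_norm]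
  have hcx : ‖c • x‖ = 1 := by rw [norm_smul, hnc, inv_mul_cancel₀ hx0]
  have hcT : T (rankOneSelf (c • x)) = rankOneSelf (c • y) := by
    rw [rankOneSelf_smul, rankOneSelf_smul, map_smul, h]
  have h1 := quadForm_map_le hT hcx hcT A
  have h2 := quadForm_map_le hT hcx hcT (-A)
  have hneg : T (-A) = -T A := T.toLinearEquiv.map_neg A
  rw [hneg, quadForm_neg, quadForm_neg] at h2
  have h3 : quadForm (T A) (c • y) = quadForm A (c • x) := by linarith
  rw [quadForm_smul, quadForm_smul] at h3
  refine mul_left_cancel₀ ?_ h3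
  rw [hnc]
  positivity

lemma norm_inner_eq_of_map_rankOneSelf (hT : T 1 = 1) {x y x' y' : H}
    (hx : T (rankOneSelf x) = rankOneSelf x') (hy : T (rankOneSelf y) = rankOneSelf y') :
    ‖(inner ℂ x' y' : ℂ)‖ = ‖(inner ℂ x y : ℂ)‖ := by
  have h := quadForm_map hT hy (rankOneSelf x)
  rw [hx, quadForm_rankOneSelf, quadForm_rankOneSelf] at h
  exact (sq_eq_sq₀ (norm_nonneg _) (norm_nonneg _)).mp h

end Unital

/-! ### Construction of the implementing operator. -/

/-- The observable `|x⟩⟨y| + |y⟩⟨x|`. -/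
def cross (x y : H) : BoundedObservable H :=
  rankOneSelf (x + y) - rankOneSelf x - rankOneSelf y

lemma cross_apply (x y z : H) :
    ((cross x y : BoundedObservable H) : H →L[ℂ] H) z =
      (inner ℂ y z : ℂ) • x + (inner ℂ x z : ℂ) • y := by
  have : ((cross x y : BoundedObservable H) : H →L[ℂ] H) z =
      (inner ℂ (x + y) z : ℂ) • (x + y) - (inner ℂ x z : ℂ) • x - (inner ℂ y z : ℂ) • y := rfl
  rw [this, inner_add_left]
  module

lemma ext_apply {A B : BoundedObservable H}
    (h : ∀ z, (A : H →L[ℂ] H) z = (B : H →L[ℂ] H) z) : A = B :=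
  Subtype.ext (ContinuousLinearMap.ext h)

lemma coe_add_apply (A B : BoundedObservable H) (x : H) :
    ((A + B : BoundedObservable H) : H →L[ℂ] H) x =
      (A : H →L[ℂ] H) x + (B : H →L[ℂ] H) x := rfl

lemma cross_add_right (e x y : H) : cross e (x + y) = cross e x + cross e y := by
  refine ext_apply fun z => ?_
  rw [coe_add_apply, cross_apply, cross_apply, cross_apply, inner_add_left]
  module

lemma cross_smul_left (c : ℂ) (x y : H) :
    cross (c • x) y = cross x ((starRingEnd ℂ) c • y) := by
  refine ext_apply fun z => ?_
  rw [cross_apply, cross_apply, inner_smul_left, inner_smul_left, Complex.conj_conj]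
  module

lemma cross_real_smul_right (r : ℝ) (x y : H) : cross x ((r : ℂ) • y) = r • cross x y := by
  refine ext_apply fun z => ?_
  rw [coe_real_smul_apply, cross_apply, cross_apply, inner_smul_left, Complex.conj_ofReal]
  module

lemma rankOneSelf_smul_add (c : ℂ) (e x : H) :
    rankOneSelf (c • e + x) =
      (‖c‖ ^ 2) • rankOneSelf e + cross e ((starRingEnd ℂ) c • x) + rankOneSelf x := by
  rw [← cross_smul_left, ← rankOneSelf_smul, cross]
  abel

lemma rankOneSelf_phase_smul {c : ℂ} (hc : ‖c‖ = 1) (x : H) :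
    rankOneSelf (c • x) = rankOneSelf x := by
  refine ext_quadForm fun z => ?_
  rw [rankOneSelf_smul, quadForm_real_smul, hc, one_pow, one_mul]

section Unital

variable {T : BoundedObservable H ≃ₗᵢ[ℝ] BoundedObservable H} {e e' : H}

/-- Let `f` and `u` represent the images of the rays of `e + x` and `x`. Fix the phase of `f` by
`⟨e', f⟩ = 1`, then that of `u` by `⟨f, u⟩ = ‖x‖ ^ 2`. Expanding `‖f - (e' + u)‖ ^ 2` gives `0`, so
`f = e' + u`. -/
lemma exists_map_cross (hT : T 1 = 1) (he : ‖e‖ = 1) (h : T (rankOneSelf e) = rankOneSelf e')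
    {x : H} (hx : (inner ℂ e x : ℂ) = 0) :
    ∃ u, T (rankOneSelf x) = rankOneSelf u ∧ (inner ℂ e' u : ℂ) = 0 ∧
      T (cross e x) = cross e' u := by
  have he' : ‖e'‖ = 1 := by rw [norm_eq_of_map_rankOneSelf h, he]
  obtain ⟨f₀, hf₀⟩ := exists_map_rankOneSelf hT (e + x)
  obtain ⟨u₀, hu₀⟩ := exists_map_rankOneSelf hT x
  obtain ⟨a, ha, haf⟩ := exists_phase_smul_inner_eq e' f₀
  have hf : T (rankOneSelf (e + x)) = rankOneSelf (a • f₀) := by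
    rw [hf₀, rankOneSelf_phase_smul ha]
  obtain ⟨b, hb, hbu⟩ := exists_phase_smul_inner_eq (a • f₀) u₀
  have hu : T (rankOneSelf x) = rankOneSelf (b • u₀) := by
    rw [hu₀, rankOneSelf_phase_smul hb]
  rw [norm_inner_eq_of_map_rankOneSelf hT h hf₀, inner_add_right, hx,
    inner_self_of_norm_eq_one he, add_zero, norm_one, Complex.ofReal_one] at haf
  rw [norm_inner_eq_of_map_rankOneSelf hT hf hu₀, inner_add_left, hx, zero_add,
    inner_self_eq_norm_sq_to_K, norm_pow] at hbu
  simp only [Complex.coe_algebraMap, Complex.norm_real, norm_norm, Complex.ofReal_pow] at hbu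
  set f := a • f₀
  set u := b • u₀
  have heu : (inner ℂ e' u : ℂ) = 0 := by
    rw [← norm_eq_zero, norm_inner_eq_of_map_rankOneSelf hT h hu, hx, norm_zero]
  have hun : ‖u‖ = ‖x‖ := norm_eq_of_map_rankOneSelf hu
  have hfn : ‖f‖ ^ 2 = 1 + ‖x‖ ^ 2 := by
    rw [norm_eq_of_map_rankOneSelf hf, sq, norm_add_sq_eq_norm_sq_add_norm_sq_of_inner_eq_zero
      e x hx, he]
    ring
  have hun2 : ‖e' + u‖ ^ 2 = 1 + ‖x‖ ^ 2 := by
    rw [sq, norm_add_sq_eq_norm_sq_add_norm_sq_of_inner_eq_zero e' u heu, he', hun]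
    ring
  have hfe : f = e' + u := by
    have h1 : (inner ℂ f e' : ℂ) = 1 := by rw [← inner_conj_symm, haf, map_one]
    have h2 := norm_sub_sq (𝕜 := ℂ) f (e' + u)
    rw [inner_add_right, h1, hbu, hfn, hun2, ← Complex.ofReal_pow, ← Complex.ofReal_one,
      ← Complex.ofReal_add] at h2
    have h3 : RCLike.re ((1 + ‖x‖ ^ 2 : ℝ) : ℂ) = 1 + ‖x‖ ^ 2 := Complex.ofReal_re _
    rw [h3] at h2
    rw [← sub_eq_zero, ← norm_eq_zero, ← sq_eq_zero_iff, h2]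
    ring
  refine ⟨u, hu, heu, ?_⟩
  rw [cross, T.map_sub, T.map_sub, h, hf, hu, hfe, cross]

/-- The component orthogonal to `e'` of the operator implementing `T`, as read off from the images
of the observables `|e⟩⟨x| + |x⟩⟨e|`. -/
def offDiag (T : BoundedObservable H ≃ₗᵢ[ℝ] BoundedObservable H) (e e' x : H) : H :=
  (T (cross e (x - (inner ℂ e x : ℂ) • e)) : H →L[ℂ] H) e'

/-- Linearity of `T` gives additivity directly, with no matching of phases as in Wigner's theorem.
-/
lemma offDiag_add (x y : H) : offDiag T e e' (x + y) = offDiag T e e' x + offDiag T e e' y := by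
  have : x + y - (inner ℂ e (x + y) : ℂ) • e =
      (x - (inner ℂ e x : ℂ) • e) + (y - (inner ℂ e y : ℂ) • e) := by
    rw [inner_add_right]
    module
  rw [offDiag, this, cross_add_right, T.map_add, coe_add_apply, offDiag, offDiag]

lemma offDiag_real_smul (r : ℝ) (x : H) :
    offDiag T e e' ((r : ℂ) • x) = (r : ℂ) • offDiag T e e' x := by
  have : (r : ℂ) • x - (inner ℂ e ((r : ℂ) • x) : ℂ) • e =
      (r : ℂ) • (x - (inner ℂ e x : ℂ) • e) := by
    rw [inner_smul_right]
    module
  rw [offDiag, this, cross_real_smul_right, T.map_smul, coe_real_smul_apply, offDiag]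

lemma offDiag_spec (hT : T 1 = 1) (he : ‖e‖ = 1) (h : T (rankOneSelf e) = rankOneSelf e') (x : H) :
    T (rankOneSelf (x - (inner ℂ e x : ℂ) • e)) = rankOneSelf (offDiag T e e' x) ∧
      (inner ℂ e' (offDiag T e e' x) : ℂ) = 0 ∧
      T (cross e (x - (inner ℂ e x : ℂ) • e)) = cross e' (offDiag T e e' x) := by
  have he' : ‖e'‖ = 1 := by rw [norm_eq_of_map_rankOneSelf h, he]
  obtain ⟨u, hu, heu, hcu⟩ := exists_map_cross hT he h (inner_sub_inner_smul_self he x)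
  have : offDiag T e e' x = u := by
    rw [offDiag, hcu, cross_apply, inner_self_of_norm_eq_one he', one_smul, ← inner_conj_symm, heu,
      map_zero, zero_smul, zero_add]
  rw [this]
  exact ⟨hu, heu, hcu⟩

/-- The values at `x` and `I • x` differ by a phase `c`. Comparing norms at `x + I • x` gives `‖1 +
c‖ = ‖1 + I‖` when the value at `x` is nonzero, so `c = ±I`. -/
lemma offDiag_I_smul (hT : T 1 = 1) (he : ‖e‖ = 1) (h : T (rankOneSelf e) = rankOneSelf e')
    (x : H) : offDiag T e e' (Complex.I • x) = Complex.I • offDiag T e e' x ∨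
      offDiag T e e' (Complex.I • x) = -(Complex.I • offDiag T e e' x) := by
  have hp : ∀ c : ℂ, c • x - (inner ℂ e (c • x) : ℂ) • e = c • (x - (inner ℂ e x : ℂ) • e) := by
    intro c
    rw [inner_smul_right]
    module
  have h1 := (offDiag_spec hT he h x).1
  have h2 := (offDiag_spec hT he h (Complex.I • x)).1
  rw [hp, rankOneSelf_phase_smul Complex.norm_I, h1] at h2
  obtain ⟨c, hc, hcI⟩ := exists_phase_of_rankOneSelf_eq h2.symm
  by_cases h0 : offDiag T e e' x = 0
  · left
    rw [hcI, h0, smul_zero, smul_zero]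
  have h3 := (offDiag_spec hT he h (x + Complex.I • x)).1
  have hsum : x + Complex.I • x = (1 + Complex.I) • x := by rw [add_smul, one_smul]
  rw [offDiag_add, hcI] at h3
  rw [hsum, hp, rankOneSelf_smul, T.map_smul, h1, ← rankOneSelf_smul] at h3
  have h4 := congrArg norm h3
  have hsum' : offDiag T e e' x + c • offDiag T e e' x = (1 + c) • offDiag T e e' x := by
    rw [add_smul, one_smul]
  rw [hsum', norm_rankOneSelf, norm_rankOneSelf, norm_smul, norm_smul, mul_pow, mul_pow] at h4
  have h5 := mul_right_cancel₀ (pow_ne_zero 2 (norm_ne_zero_iff.mpr h0)) h4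
  rw [← Complex.normSq_eq_norm_sq, ← Complex.normSq_eq_norm_sq, Complex.normSq_apply,
    Complex.normSq_apply] at h5
  have h6 : ‖c‖ ^ 2 = 1 := by rw [hc, one_pow]
  rw [← Complex.normSq_eq_norm_sq, Complex.normSq_apply] at h6
  simp only [Complex.add_re, Complex.add_im, Complex.one_re, Complex.one_im, Complex.I_re,
    Complex.I_im] at h5
  have hre : c.re = 0 := by linarith
  have him : c.im = 1 ∨ c.im = -1 := by
    rw [hre] at h6
    exact mul_self_eq_one_iff.mp (by linarith)
  rw [hcI]
  rcases him with him | him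
  · left
    rw [show c = Complex.I from Complex.ext hre him]
  · right
    rw [show c = -Complex.I from Complex.ext (by simp [hre]) (by simp [him]), neg_smul]

lemma offDiag_semilinear (hT : T 1 = 1) (he : ‖e‖ = 1) (h : T (rankOneSelf e) = rankOneSelf e') :
    (∀ (c : ℂ) (x : H), offDiag T e e' (c • x) = c • offDiag T e e' x) ∨
      (∀ (c : ℂ) (x : H), offDiag T e e' (c • x) = (starRingEnd ℂ) c • offDiag T e e' x) := by
  have hsplit : ∀ (c : ℂ) (x : H), offDiag T e e' (c • x) =
      (c.re : ℂ) • offDiag T e e' x + (c.im : ℂ) • offDiag T e e' (Complex.I • x) := by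
    intro c x
    rw [← offDiag_real_smul, ← offDiag_real_smul, ← offDiag_add, smul_smul, ← add_smul,
      Complex.re_add_im]
  refine (eq_or_eq_neg_of_forall (fun x y => ?_) (fun x y => ?_) (offDiag_I_smul hT he h)).imp
    (fun h1 c x => ?_) (fun h1 c x => ?_)
  · rw [smul_add, offDiag_add]
  · rw [offDiag_add, smul_add]
  · rw [hsplit, h1, smul_smul, ← add_smul, Complex.re_add_im]
  · rw [hsplit, h1, smul_neg, smul_smul, ← neg_smul, ← add_smul]
    congr 1
    apply Complex.ext <;> simp

/-- If the off-diagonal part is semilinear then `T` is implemented on rank-one observables by a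
semilinear isometric bijection. -/
lemma exists_isometryEquiv_of_offDiag {σ σ' : ℂ →+* ℂ} [RingHomInvPair σ σ'] [RingHomInvPair σ' σ]
    (hσ : ∀ c, ‖σ c‖ = ‖c‖) (hσ_conj : ∀ c, σ ((starRingEnd ℂ) c) = (starRingEnd ℂ) (σ c))
    (hT : T 1 = 1) (he : ‖e‖ = 1) (h : T (rankOneSelf e) = rankOneSelf e')
    (hlin : ∀ (c : ℂ) (x : H), offDiag T e e' (c • x) = σ c • offDiag T e e' x) :
    ∃ U : H ≃ₛₗᵢ[σ] H, ∀ y, T (rankOneSelf y) = rankOneSelf (U y) := by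
  -- Write `y = α e + w` with `w ⊥ e`. By `rankOneSelf_smul_add`, `|y⟩⟨y|` splits into multiples of
  -- `|e⟩⟨e|`, a cross term in `conj α • w`, and `|w⟩⟨w|`, whose images are all known.
  set U₀ : H → H := fun y => σ (inner ℂ e y) • e' + offDiag T e e' y with hU₀
  have hU₀T : ∀ y, T (rankOneSelf y) = rankOneSelf (U₀ y) := by
    intro y
    obtain ⟨h1, -, -⟩ := offDiag_spec hT he h y
    obtain ⟨-, -, h3⟩ := offDiag_spec hT he h ((starRingEnd ℂ) (inner ℂ e y : ℂ) • y)
    have hp : (starRingEnd ℂ) (inner ℂ e y : ℂ) • y -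
        (inner ℂ e ((starRingEnd ℂ) (inner ℂ e y : ℂ) • y) : ℂ) • e =
        (starRingEnd ℂ) (inner ℂ e y : ℂ) • (y - (inner ℂ e y : ℂ) • e) := by
      rw [inner_smul_right]
      module
    rw [hp, hlin, hσ_conj] at h3
    have hy : y = (inner ℂ e y : ℂ) • e + (y - (inner ℂ e y : ℂ) • e) := by abel
    conv_lhs => rw [hy]
    rw [rankOneSelf_smul_add, T.map_add, T.map_add, T.map_smul, h, h1, h3, hU₀,
      rankOneSelf_smul_add, hσ]
  let U₁ : H →ₛₗᵢ[σ] H :=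
    { toFun := U₀
      map_add' := fun x y => by
        simp only [hU₀]
        rw [inner_add_right, map_add, offDiag_add]
        module
      map_smul' := fun c x => by
        simp only [hU₀]
        rw [inner_smul_right, map_mul, hlin]
        module
      norm_map' := fun y => norm_eq_of_map_rankOneSelf (hU₀T y) }
  have hsurj : Function.Surjective U₁ := by
    intro z
    -- Since `T.symm` also preserves rank-one observables, `z` is a phase times some `U₀ y`, and
    -- `σ'` pulls the phase back.
    obtain ⟨y, hy⟩ := exists_map_rankOneSelf (symm_map_one hT) z
    rw [LinearIsometryEquiv.symm_apply_eq, hU₀T] at hy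
    obtain ⟨c, -, hc⟩ := exists_phase_of_rankOneSelf_eq hy
    refine ⟨σ' c • y, ?_⟩
    rw [LinearIsometry.map_smulₛₗ, RingHomInvPair.comp_apply_eq₂]
    exact hc.symm
  exact ⟨LinearIsometryEquiv.ofSurjective U₁ hsurj, hU₀T⟩

end Unital

/-! ### From rank-one observables to all observables. -/

/-- On a complex space the quadratic form determines the operator, and `quadForm_map` computes that
of `T A` at every `U y`. -/
lemma coe_map_eq_of_rankOneSelf {T : BoundedObservable H ≃ₗᵢ[ℝ] BoundedObservable H}
    (hT : T 1 = 1) {U : H → H} (hU : Function.Surjective U)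
    (hTU : ∀ y, T (rankOneSelf y) = rankOneSelf (U y)) {A : BoundedObservable H} {B : H →L[ℂ] H}
    (hB : ∀ y, inner ℂ (U y) (B (U y)) = (quadForm A y : ℂ)) : (T A : H →L[ℂ] H) = B := by
  rw [← ContinuousLinearMap.coe_inj, ← ext_inner_map]
  intro z
  obtain ⟨y, rfl⟩ := hU z
  rw [← inner_conj_symm, ← inner_conj_symm (B.toLinearMap _)]
  congr 1
  refine Eq.trans ?_ (hB y).symm
  rw [← quadForm_map hT (hTU y) A]
  exact inner_self_apply _ _

lemma coe_map_eq_unitary_conj {T : BoundedObservable H ≃ₗᵢ[ℝ] BoundedObservable H}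
    (hT : T 1 = 1) {U : H ≃ₗᵢ[ℂ] H} (hTU : ∀ y, T (rankOneSelf y) = rankOneSelf (U y)) :
    ∃ V : unitary (H →L[ℂ] H), ∀ A : BoundedObservable H, (T A : H →L[ℂ] H) =
      (V : H →L[ℂ] H) * (A : H →L[ℂ] H) * star (V : H →L[ℂ] H) := by
  set V := Unitary.linearIsometryEquiv.symm U with hV
  have hVU : ∀ y, (V : H →L[ℂ] H) y = U y := fun y => by
    rw [hV, Unitary.coe_symm_linearIsometryEquiv_apply]
    rfl
  refine ⟨V, fun A => coe_map_eq_of_rankOneSelf hT U.surjective hTU fun y => ?_⟩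
  have h1 : star (V : H →L[ℂ] H) (U y) = y := by
    rw [← hVU]
    exact DFunLike.congr_fun (Unitary.coe_star_mul_self V) y
  rw [mul_apply_eq_comp, mul_apply_eq_comp, h1, hVU,
    LinearIsometryEquiv.inner_map_map, inner_self_apply]

lemma coe_map_eq_antiunitary_conj {T : BoundedObservable H ≃ₗᵢ[ℝ] BoundedObservable H}
    (hT : T 1 = 1) {U : AntiunitaryOp H} (hTU : ∀ y, T (rankOneSelf y) = rankOneSelf (U y))
    (A : BoundedObservable H) : (T A : H →L[ℂ] H) = U.conj (A : H →L[ℂ] H) := by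
  refine coe_map_eq_of_rankOneSelf hT U.surjective hTU fun y => ?_
  rw [AntiunitaryOp.conj_apply, AntiunitaryOp.adjoint, LinearIsometryEquiv.symm_apply_apply,
    AntiunitaryOp.inner_map_map, inner_apply_left, inner_self_apply]

/-- A unital surjective linear isometry of `B_s(H)` is conjugation by a unitary or antiunitary
operator. -/
theorem exists_conj_of_map_one [Nontrivial H]
    {T : BoundedObservable H ≃ₗᵢ[ℝ] BoundedObservable H} (hT : T 1 = 1) :
    (∃ U : unitary (H →L[ℂ] H), ∀ A : BoundedObservable H, (T A : H →L[ℂ] H) =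
      (U : H →L[ℂ] H) * (A : H →L[ℂ] H) * star (U : H →L[ℂ] H)) ∨
    (∃ U : AntiunitaryOp H, ∀ A : BoundedObservable H,
      (T A : H →L[ℂ] H) = U.conj (A : H →L[ℂ] H)) := by
  obtain ⟨e, he⟩ := exists_norm_eq H (zero_le_one (α := ℝ))
  obtain ⟨e', h⟩ := exists_map_rankOneSelf hT e
  rcases offDiag_semilinear hT he h with hlin | hlin
  · obtain ⟨U, hU⟩ := exists_isometryEquiv_of_offDiag (σ := RingHom.id ℂ) (σ' := RingHom.id ℂ)
      (fun _ => rfl) (fun _ => rfl) hT he h hlin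
    exact Or.inl (coe_map_eq_unitary_conj hT hU)
  · obtain ⟨U, hU⟩ := exists_isometryEquiv_of_offDiag (σ := starRingEnd ℂ) (σ' := starRingEnd ℂ)
      (fun c => RCLike.norm_conj c) (fun _ => rfl) hT he h hlin
    exact Or.inr ⟨U, coe_map_eq_antiunitary_conj hT hU⟩

/-! ### Reduction to linear isometries and conclusion. -/

/-- The Mazur–Ulam theorem for `d_m`: up to a translation, a bijection preserving `d_m` is a real
linear isometry. -/
lemma exists_linearIsometryEquiv_of_meanDist {φ : BoundedObservable H → BoundedObservable H}
    (hbij : Function.Bijective φ)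
    (hdist : ∀ A B : BoundedObservable H, meanDist (φ A) (φ B) = meanDist A B) :
    ∃ T : BoundedObservable H ≃ₗᵢ[ℝ] BoundedObservable H, ∀ A, φ A = T A + φ 0 := by
  have hiso : Isometry φ := Isometry.of_dist_eq fun A B => by
    have h := hdist A B
    rw [meanDist_eq_norm, meanDist_eq_norm] at h
    rw [dist_eq_norm, dist_eq_norm]
    exact h
  let f : BoundedObservable H ≃ᵢ BoundedObservable H := ⟨Equiv.ofBijective φ hbij, hiso⟩
  refine ⟨f.toRealLinearIsometryEquiv, fun A => ?_⟩
  have : f.toRealLinearIsometryEquiv A = φ A - φ 0 := f.toRealLinearIsometryEquiv_apply A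
  rw [this, sub_add_cancel]

end BoundedObservable

end

/-- Every bijection of `B_s(H)` that preserves `d_m` is `A ↦ ±U A U* + X` with `U` unitary or
antiunitary and `X` self-adjoint. -/
theorem theorem3 {H : Type*} [NormedAddCommGroup H] [InnerProductSpace ℂ H] [CompleteSpace H]
    (φ : BoundedObservable H → BoundedObservable H) (hbij : Function.Bijective φ)
    (hdist : ∀ A B : BoundedObservable H, meanDist (φ A) (φ B) = meanDist A B) :
    ∃ X : BoundedObservable H,
      (∃ U : unitary (H →L[ℂ] H),
        (∀ A : BoundedObservable H, (φ A : H →L[ℂ] H) =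
          (U : H →L[ℂ] H) * (A : H →L[ℂ] H) * star (U : H →L[ℂ] H) + (X : H →L[ℂ] H)) ∨
        (∀ A : BoundedObservable H, (φ A : H →L[ℂ] H) =
          -((U : H →L[ℂ] H) * (A : H →L[ℂ] H) * star (U : H →L[ℂ] H)) + (X : H →L[ℂ] H))) ∨
      (∃ U : AntiunitaryOp H,
        (∀ A : BoundedObservable H, (φ A : H →L[ℂ] H) =
          U.conj (A : H →L[ℂ] H) + (X : H →L[ℂ] H)) ∨
        (∀ A : BoundedObservable H, (φ A : H →L[ℂ] H) =
          -U.conj (A : H →L[ℂ] H) + (X : H →L[ℂ] H))) := by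

  obtain ⟨T, hTφ⟩ := BoundedObservable.exists_linearIsometryEquiv_of_meanDist hbij hdist
  have hφ : ∀ A, (φ A : H →L[ℂ] H) = (T A : H →L[ℂ] H) + (φ 0 : H →L[ℂ] H) := fun A =>
    congrArg Subtype.val (hTφ A)
  refine ⟨φ 0, ?_⟩
  -- The zero space has no unit vector and is settled separately.
  rcases subsingleton_or_nontrivial H with hH | hH
  · exact Or.inl ⟨1, Or.inl fun A => ContinuousLinearMap.ext fun x => Subsingleton.elim _ _⟩
  rcases BoundedObservable.map_one_eq_or T with h1 | h1
  · refine (BoundedObservable.exists_conj_of_map_one h1).imp ?_ ?_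
    all_goals
      rintro ⟨U, hU⟩
      exact ⟨U, Or.inl fun A => by rw [hφ, hU]⟩
  · set S : BoundedObservable H ≃ₗᵢ[ℝ] BoundedObservable H :=
      T.trans (LinearIsometryEquiv.neg ℝ) with hS
    have hS1 : S 1 = 1 := by
      change -(T 1) = 1
      rw [h1, neg_neg]
    have hTS : ∀ A, (T A : H →L[ℂ] H) = -(S A : H →L[ℂ] H) := fun A => (neg_neg _).symm
    refine (BoundedObservable.exists_conj_of_map_one hS1).imp ?_ ?_
    all_goals
      rintro ⟨U, hU⟩
      exact ⟨U, Or.inr fun A => by rw [hφ, hTS, hU]⟩
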